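/- Let $S$ be a two-dimensional manifold without boundary of class $C^2$ (Hausdorff and second countable, not necessarily connected), and let $f : S \to \mathbb R^3$ be a $C^2$ immersion whose mean curvature vanishes identically. Assume that the surface is complete, that is, every Cauchy sequence for the Riemannian distance on $S$ of the metric induced by $f$ converges in $S$. Let $M = f(S) \subset \mathbb R^3$ be the corresponding complete (immersed, possibly embedded) minimal surface. If $M$ contains a segment $[p,q]$, $p \neq q$, of a straight line $D$, then it contains the whole line: $D \subset M$. -/

import Mathlib

open Set Filter Topology MeasureTheory
open scoped Manifold ContDiff ENNReal

/-- The Euclidean plane, the model space of surfaces. -/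
abbrev Plane : Type := EuclideanSpace ℝ (Fin 2)

/-- Euclidean three-space. -/
abbrev Space : Type := EuclideanSpace ℝ (Fin 3)

noncomputable section

/-! ### Classical surface theory of a local parametrization `X : ℝ² → ℝ³` -/

/-- The partial derivative `∂ᵢ X` of a parametrization. -/
def partialD (i : Fin 2) (X : Plane → Space) (p : Plane) : Space :=
  fderiv ℝ X p (EuclideanSpace.single i 1)

/-- The vector product of `ℝ³`. -/
def vecProd (a b : Space) : Space :=
  WithLp.toLp 2 (crossProduct a.ofLp b.ofLp)

/-- The unit normal `(X_u × X_v) / |X_u × X_v|`. -/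
def unitNormal (X : Plane → Space) (p : Plane) : Space :=
  ‖vecProd (partialD 0 X p) (partialD 1 X p)‖⁻¹ • vecProd (partialD 0 X p) (partialD 1 X p)

/-- The coefficients `⟨X_i, X_j⟩` of the first fundamental form. -/
def firstForm (X : Plane → Space) (p : Plane) (i j : Fin 2) : ℝ :=
  inner ℝ (partialD i X p) (partialD j X p)

/-- The coefficients `⟨X_ij, N⟩` of the second fundamental form. -/
def secondForm (X : Plane → Space) (p : Plane) (i j : Fin 2) : ℝ :=
  inner ℝ (partialD i (partialD j X) p) (unitNormal X p)

/-- The mean curvature `H = (e G - 2 f F + g E) / (2 (E G - F²))`. -/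
def meanCurvature (X : Plane → Space) (p : Plane) : ℝ :=
  (secondForm X p 0 0 * firstForm X p 1 1 - 2 * secondForm X p 0 1 * firstForm X p 0 1
      + secondForm X p 1 1 * firstForm X p 0 0)
    / (2 * (firstForm X p 0 0 * firstForm X p 1 1 - firstForm X p 0 1 ^ 2))

/-! ### Immersed surfaces -/

section Surfaces

variable {S : Type*} [TopologicalSpace S] [ChartedSpace Plane S]

/-- `f : S → ℝ³` is a minimal immersion of the surface `S`: it is a `C²` immersion, and its mean
curvature vanishes identically, as computed in any local coordinates of `S`. -/
structure IsMinimalImmersion (f : S → Space) : Prop where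
  contMDiff : ContMDiff (𝓡 2) 𝓘(ℝ, Space) 2 f
  injective_mfderiv : ∀ x : S, Function.Injective (mfderiv (𝓡 2) 𝓘(ℝ, Space) f x)
  meanCurvature_eq_zero : ∀ e ∈ IsManifold.maximalAtlas (𝓡 2) 2 S, ∀ x ∈ e.source,
    meanCurvature (f ∘ e.symm) (e x) = 0

/-- The Riemannian distance on `S` of the metric induced by the immersion `f : S → ℝ³`: the infimum
of the lengths of the `C¹` paths of `S` from `x` to `y`, the length of `γ` in the induced metric
being the Euclidean length of `f ∘ γ`. It is `∞` if there is no such path. -/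
def intrinsicEDist (f : S → Space) (x y : S) : ℝ≥0∞ :=
  sInf {L : ℝ≥0∞ | ∃ (a b : ℝ) (γ : ℝ → S), a ≤ b ∧
    ContMDiffOn 𝓘(ℝ, ℝ) (𝓡 2) 1 γ (Icc a b) ∧ γ a = x ∧ γ b = y ∧
    L = ∫⁻ t in Icc a b, ‖derivWithin (f ∘ γ) (Icc a b) t‖ₑ}

/-- The immersed surface `f : S → ℝ³` is complete: every Cauchy sequence for the Riemannian
distance of the induced metric converges in `S`. -/
def IsCompleteSurface (f : S → Space) : Prop :=
  ∀ u : ℕ → S,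
    (∀ ε : ℝ≥0∞, 0 < ε → ∃ N : ℕ, ∀ m ≥ N, ∀ n ≥ N, intrinsicEDist f (u m) (u n) < ε) →
    ∃ x : S, Tendsto u atTop (𝓝 x)

end Surfaces

end

/-! ### Vector algebra in `ℝ³` -/

/-! Where the mean curvature vanishes, the vector-valued form `N × dX` is closed
(`vecProd_fderiv_unitNormal_symm`), so locally `X` is the real part of a primitive of `dX - i N ×
dX`. Near a point where `v` is a unit tangent vector, the `v`-component of this primitive is a
complex coordinate, in which every component of `X` is the real part of a holomorphic function
(`exists_conformal_coordinates`).

A curve of the surface lying over `t ↦ p + t • v` has velocity `|v|² - i ⟨v, N × v⟩ = 1` in this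
coordinate, so it is a horizontal segment. Prolong that segment inside the chart: `X` is real
analytic along it, hence stays on the line by the identity theorem. The length gained depends on the
chart only, not on the curve (`exists_line_lift`).

Intrinsic distances along such a lift are at most the differences of the parameters, so completeness
gives a limit point at a finite end. There `v` is still tangent, by continuity of `N`, and the
uniform extension passes the end (`IsMinimalImmersion.exists_extension_of_tendsto`); lifts therefore
extend forever. An initial lift is not given, since the preimages of the points of the segment may
be scattered over `S`; Baire's theorem provides one (`IsMinimalImmersion.exists_isLineLift`). -/

theorem inner_eq_sum_three (a b : Space) :
    inner ℝ a b = a 0 * b 0 + a 1 * b 1 + a 2 * b 2 := by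
  simp [PiLp.inner_apply, Fin.sum_univ_three, mul_comm]

@[simp] theorem vecProd_zero_coord (a b : Space) : vecProd a b 0 = a 1 * b 2 - a 2 * b 1 := by
  simp [vecProd, cross_apply]

@[simp] theorem vecProd_one_coord (a b : Space) : vecProd a b 1 = a 2 * b 0 - a 0 * b 2 := by
  simp [vecProd, cross_apply]

@[simp] theorem vecProd_two_coord (a b : Space) : vecProd a b 2 = a 0 * b 1 - a 1 * b 0 := by
  simp [vecProd, cross_apply]

theorem space_ext {a b : Space} (h0 : a 0 = b 0) (h1 : a 1 = b 1) (h2 : a 2 = b 2) : a = b := by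
  ext i
  fin_cases i <;> assumption

theorem inner_vecProd_comm (a b c : Space) :
    inner ℝ (vecProd a b) c = inner ℝ a (vecProd b c) := by
  simp only [inner_eq_sum_three, vecProd_zero_coord, vecProd_one_coord, vecProd_two_coord]
  ring

theorem vecProd_vecProd (a b c : Space) :
    vecProd a (vecProd b c) = (inner ℝ a c : ℝ) • b - (inner ℝ a b : ℝ) • c := by
  apply space_ext <;> simp [inner_eq_sum_three] <;> ring

theorem inner_vecProd_self_add (a b : Space) :
    inner ℝ (vecProd a b) (vecProd a b) + inner ℝ a b ^ 2 = inner ℝ a a * (inner ℝ b b : ℝ) := by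
  simp only [inner_eq_sum_three, vecProd_zero_coord, vecProd_one_coord, vecProd_two_coord]
  ring

@[simp] theorem vecProd_add (a b c : Space) : vecProd a (b + c) = vecProd a b + vecProd a c := by
  apply space_ext <;> simp <;> ring

@[simp] theorem vecProd_smul (r : ℝ) (a b : Space) : vecProd a (r • b) = r • vecProd a b := by
  apply space_ext <;> simp <;> ring

theorem vecProd_self (a : Space) : vecProd a a = 0 := by
  apply space_ext <;> simp <;> ring

theorem vecProd_smul_left (r : ℝ) (a b : Space) : vecProd (r • a) b = r • vecProd a b := by
  apply space_ext <;> simp <;> ring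

theorem vecProd_add_left (a b c : Space) : vecProd (a + b) c = vecProd a c + vecProd b c := by
  apply space_ext <;> simp <;> ring

theorem eq_zero_of_vecProd_eq_zero_of_inner_eq_zero {a b : Space} (hb : b ≠ 0)
    (h : vecProd a b = 0) (h' : inner ℝ a b = (0 : ℝ)) : a = 0 := by
  have key := inner_vecProd_self_add a b
  rw [h, h'] at key
  have hb' : (inner ℝ b b : ℝ) ≠ 0 := inner_self_ne_zero.2 hb
  have : (inner ℝ a a : ℝ) = 0 := by
    have : inner ℝ a a * (inner ℝ b b : ℝ) = 0 := by rw [← key]; simp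
    exact (mul_eq_zero.1 this).resolve_right hb'
  exact inner_self_eq_zero.1 this

/-- Expansion in the frame `x`, `y`, `x × y`, cleared of its denominator, the Gram determinant `|x ×
y|²`. -/
theorem smul_eq_of_inner_vecProd (x y w : Space) :
    (inner ℝ (vecProd x y) (vecProd x y) : ℝ) • w =
      (inner ℝ x w * inner ℝ y y - inner ℝ y w * inner ℝ x y : ℝ) • x
        + (inner ℝ y w * inner ℝ x x - inner ℝ x w * inner ℝ x y : ℝ) • y
        + (inner ℝ (vecProd x y) w : ℝ) • vecProd x y := by
  apply space_ext <;> simp only [inner_eq_sum_three, vecProd_zero_coord, vecProd_one_coord, vecProd_two_coord, PiLp.add_apply, PiLp.smul_apply, smul_eq_mul] <;> ring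

theorem linearDependent_of_vecProd_eq_zero {x y : Space} (h : vecProd x y = 0) :
    ∃ a b : ℝ, (a ≠ 0 ∨ b ≠ 0) ∧ a • x + b • y = 0 := by
  by_cases hx : x = 0
  · exact ⟨1, 0, by simp, by simp [hx]⟩
  · refine ⟨inner ℝ x y, -inner ℝ x x, Or.inr (by simpa using hx), ?_⟩
    have := vecProd_vecProd x x y
    rw [h] at this
    rw [neg_smul, ← sub_eq_add_neg, ← this]
    simp [vecProd]

/-- The algebraic content of the closedness of `N × dX` on a surface with zero mean curvature. -/
theorem vecProd_eq_vecProd_of_trace_eq_zero {n n0 n1 x0 x1 : Space} (hx : vecProd x0 x1 ≠ 0)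
    (hn : inner ℝ n n = (1 : ℝ)) (hx0 : inner ℝ n x0 = (0 : ℝ)) (hx1 : inner ℝ n x1 = (0 : ℝ))
    (h0 : inner ℝ n n0 = (0 : ℝ)) (h1 : inner ℝ n n1 = (0 : ℝ))
    (hH : inner ℝ n0 x0 * inner ℝ x1 x1 - (inner ℝ n0 x1 + inner ℝ n1 x0) * inner ℝ x0 x1
      + inner ℝ n1 x1 * inner ℝ x0 x0 = (0 : ℝ)) :
    vecProd n0 x1 = vecProd n1 x0 := by
  -- Since `n` is a unit normal, `x0 × x1` is a multiple of `n`, hence orthogonal to `n0` and `n1`.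
  have hm : vecProd x0 x1 = (inner ℝ n (vecProd x0 x1) : ℝ) • n := by
    have e1 : vecProd n (vecProd x0 x1) = 0 := by rw [vecProd_vecProd, hx0, hx1]; simp
    have e2 := vecProd_vecProd n n (vecProd x0 x1)
    rw [e1, hn, one_smul] at e2
    have e3 : vecProd n 0 = 0 := by simp [vecProd]
    rw [e3] at e2
    exact (sub_eq_zero.1 e2.symm).symm
  have m0 : inner ℝ n0 (vecProd x0 x1) = (0 : ℝ) := by
    rw [hm, inner_smul_right, real_inner_comm n n0, h0, mul_zero]
  have m1 : inner ℝ n1 (vecProd x0 x1) = (0 : ℝ) := by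
    rw [hm, inner_smul_right, real_inner_comm n n1, h1, mul_zero]
  rw [← sub_eq_zero]
  -- The difference is orthogonal to `x0` and `x1`, so parallel to `x0 × x1`; its component along
  -- `x0 × x1` is exactly the trace in `hH`.
  refine eq_zero_of_vecProd_eq_zero_of_inner_eq_zero hx ?_ ?_
  · have a0 : inner ℝ (vecProd n0 x1 - vecProd n1 x0) x0 = (0 : ℝ) := by
      rw [← neg_eq_zero, ← m0]
      simp only [inner_eq_sum_three, vecProd_zero_coord, vecProd_one_coord, vecProd_two_coord,
        PiLp.sub_apply]
      ring
    have a1 : inner ℝ (vecProd n0 x1 - vecProd n1 x0) x1 = (0 : ℝ) := by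
      rw [← neg_eq_zero, ← m1]
      simp only [inner_eq_sum_three, vecProd_zero_coord, vecProd_one_coord, vecProd_two_coord,
        PiLp.sub_apply]
      ring
    rw [vecProd_vecProd, a0, a1]
    simp
  · rw [← hH]
    simp only [inner_eq_sum_three, vecProd_zero_coord, vecProd_one_coord, vecProd_two_coord,
      PiLp.sub_apply]
    ring

theorem contDiff_vecProd {n : WithTop ℕ∞} :
    ContDiff ℝ n fun q : Space × Space => vecProd q.1 q.2 := by
  have h1 (i : Fin 3) : ContDiff ℝ n fun q : Space × Space => q.1 i :=
    (contDiff_euclidean.1 contDiff_id i).comp contDiff_fst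
  have h2 (i : Fin 3) : ContDiff ℝ n fun q : Space × Space => q.2 i :=
    (contDiff_euclidean.1 contDiff_id i).comp contDiff_snd
  refine contDiff_euclidean.2 fun i => ?_
  fin_cases i
  · simpa using ((h1 1).mul (h2 2)).sub ((h1 2).mul (h2 1))
  · simpa using ((h1 2).mul (h2 0)).sub ((h1 0).mul (h2 2))
  · simpa using ((h1 0).mul (h2 1)).sub ((h1 1).mul (h2 0))

/-- The vector product with a fixed vector, as a continuous linear map. -/
noncomputable def vecProdCLM (a : Space) : Space →L[ℝ] Space :=
  LinearMap.toContinuousLinearMap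
    { toFun := vecProd a
      map_add' := vecProd_add a
      map_smul' := fun r b => vecProd_smul r a b }

@[simp] theorem vecProdCLM_apply (a b : Space) : vecProdCLM a b = vecProd a b := rfl

/-! ### Immersions of plane domains -/

theorem plane_eq_sum (a : Plane) :
    a = a 0 • EuclideanSpace.single 0 (1 : ℝ) + a 1 • EuclideanSpace.single 1 (1 : ℝ) := by
  ext i
  fin_cases i <;> simp

theorem map_plane_eq {F : Type*} [NormedAddCommGroup F] [NormedSpace ℝ F] (L : Plane →L[ℝ] F)
    (a : Plane) : L a = a 0 • L (EuclideanSpace.single 0 (1 : ℝ))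
      + a 1 • L (EuclideanSpace.single 1 (1 : ℝ)) := by
  conv_lhs => rw [plane_eq_sum a]
  simp only [map_add, map_smul]

theorem fderiv_apply_eq_partialD (X : Plane → Space) (z a : Plane) :
    fderiv ℝ X z a = a 0 • partialD 0 X z + a 1 • partialD 1 X z :=
  map_plane_eq _ a

section Parametrized

variable {X : Plane → Space} {U : Set Plane} {z : Plane}

theorem vecProd_partialD_ne_zero (h : Function.Injective (fderiv ℝ X z)) :
    vecProd (partialD 0 X z) (partialD 1 X z) ≠ 0 := by
  intro h0
  obtain ⟨a, b, hab, e⟩ := linearDependent_of_vecProd_eq_zero h0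
  have : fderiv ℝ X z (!₂[a, b]) = fderiv ℝ X z 0 := by
    rw [fderiv_apply_eq_partialD, map_zero]
    simpa using e
  have h2 := h this
  have ha : a = 0 := by simpa using congrArg (fun t : Plane => t 0) h2
  have hb : b = 0 := by simpa using congrArg (fun t : Plane => t 1) h2
  tauto

theorem inner_unitNormal_self (h : Function.Injective (fderiv ℝ X z)) :
    inner ℝ (unitNormal X z) (unitNormal X z) = (1 : ℝ) := by
  have := norm_ne_zero_iff.2 (vecProd_partialD_ne_zero h)
  rw [unitNormal, inner_smul_left, inner_smul_right, real_inner_self_eq_norm_sq]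
  simp only [conj_trivial]
  field_simp

theorem inner_unitNormal_fderiv (X : Plane → Space) (z a : Plane) :
    inner ℝ (unitNormal X z) (fderiv ℝ X z a) = (0 : ℝ) := by
  rw [fderiv_apply_eq_partialD, unitNormal, inner_smul_left]
  refine mul_eq_zero_of_right _ ?_
  simp only [inner_eq_sum_three, vecProd_zero_coord, vecProd_one_coord, vecProd_two_coord,
    PiLp.add_apply, PiLp.smul_apply, smul_eq_mul]
  ring

theorem exists_fderiv_eq_of_inner_unitNormal (h : Function.Injective (fderiv ℝ X z)) {w : Space}
    (hw : inner ℝ (unitNormal X z) w = (0 : ℝ)) : ∃ a, fderiv ℝ X z a = w := by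
  have hne := vecProd_partialD_ne_zero h
  set x := partialD 0 X z
  set y := partialD 1 X z
  have hw' : inner ℝ (vecProd x y) w = (0 : ℝ) := by
    rw [unitNormal, inner_smul_left] at hw
    exact (mul_eq_zero.1 hw).resolve_left (by simpa using hne)
  have key := smul_eq_of_inner_vecProd x y w
  have hm : (inner ℝ (vecProd x y) (vecProd x y) : ℝ) ≠ 0 := inner_self_ne_zero.2 hne
  rw [hw', zero_smul, add_zero] at key
  refine ⟨(inner ℝ (vecProd x y) (vecProd x y) : ℝ)⁻¹ •
    !₂[(inner ℝ x w * inner ℝ y y - inner ℝ y w * inner ℝ x y : ℝ),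
      (inner ℝ y w * inner ℝ x x - inner ℝ x w * inner ℝ x y : ℝ)], ?_⟩
  rw [map_smul, fderiv_apply_eq_partialD, inv_smul_eq_iff₀ hm, key]
  simp [x, y]

theorem contDiffOn_partialD (hU : IsOpen U) (hX : ContDiffOn ℝ 2 X U) (i : Fin 2) :
    ContDiffOn ℝ 1 (partialD i X) U :=
  (hX.fderiv_of_isOpen hU (by norm_num)).clm_apply contDiffOn_const

theorem contDiffOn_unitNormal (hU : IsOpen U) (hX : ContDiffOn ℝ 2 X U)
    (him : ∀ z ∈ U, Function.Injective (fderiv ℝ X z)) : ContDiffOn ℝ 1 (unitNormal X) U := by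
  have h : ContDiffOn ℝ 1 (fun z => vecProd (partialD 0 X z) (partialD 1 X z)) U :=
    contDiff_vecProd.comp_contDiffOn
      ((contDiffOn_partialD hU hX 0).prodMk (contDiffOn_partialD hU hX 1))
  have hne : ∀ z ∈ U, vecProd (partialD 0 X z) (partialD 1 X z) ≠ 0 :=
    fun z hz => vecProd_partialD_ne_zero (him z hz)
  exact ((h.norm ℝ hne).inv fun z hz => norm_ne_zero_iff.2 (hne z hz)).smul h

theorem partialD_partialD (hU : IsOpen U) (hX : ContDiffOn ℝ 2 X U) (hz : z ∈ U) (i j : Fin 2) :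
    partialD i (partialD j X) z = fderiv ℝ (fderiv ℝ X) z (EuclideanSpace.single i 1)
      (EuclideanSpace.single j 1) := by
  have h : DifferentiableAt ℝ (fderiv ℝ X) z :=
    ((hX.fderiv_of_isOpen hU (m := 1) (by norm_num)).contDiffAt (hU.mem_nhds hz)).differentiableAt
      one_ne_zero
  have : partialD j X = fun z => fderiv ℝ X z (EuclideanSpace.single j 1) := rfl
  rw [partialD, this, fderiv_clm_apply h (differentiableAt_const _)]
  simp

theorem isSymmSndFDerivAt_of_contDiffOn (hU : IsOpen U) (hX : ContDiffOn ℝ 2 X U) (hz : z ∈ U) :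
    IsSymmSndFDerivAt ℝ X z :=
  (hX.contDiffAt (hU.mem_nhds hz)).isSymmSndFDerivAt (by simp)

theorem inner_fderiv_unitNormal_self (hU : IsOpen U) (hX : ContDiffOn ℝ 2 X U)
    (him : ∀ z ∈ U, Function.Injective (fderiv ℝ X z)) (hz : z ∈ U) (a : Plane) :
    inner ℝ (unitNormal X z) (fderiv ℝ (unitNormal X) z a) = (0 : ℝ) := by
  have hN : DifferentiableAt ℝ (unitNormal X) z :=
    ((contDiffOn_unitNormal hU hX him).contDiffAt (hU.mem_nhds hz)).differentiableAt one_ne_zero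
  have h := fderiv_inner_apply ℝ hN hN a
  have h1 : (fun z => inner ℝ (unitNormal X z) (unitNormal X z)) =ᶠ[𝓝 z] fun _ => (1 : ℝ) := by
    filter_upwards [hU.mem_nhds hz] with y hy using inner_unitNormal_self (him y hy)
  rw [h1.fderiv_eq] at h
  rw [real_inner_comm (unitNormal X z) (fderiv ℝ (unitNormal X) z a)] at h
  simp at h
  linarith

/-- Weingarten's relation, obtained by differentiating `⟨N, dX b⟩ = 0`. -/
theorem inner_fderiv_unitNormal_add (hU : IsOpen U) (hX : ContDiffOn ℝ 2 X U)
    (him : ∀ z ∈ U, Function.Injective (fderiv ℝ X z)) (hz : z ∈ U) (a b : Plane) :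
    inner ℝ (fderiv ℝ (unitNormal X) z a) (fderiv ℝ X z b)
      = -(inner ℝ (fderiv ℝ (fderiv ℝ X) z a b) (unitNormal X z) : ℝ) := by
  have hN : DifferentiableAt ℝ (unitNormal X) z :=
    ((contDiffOn_unitNormal hU hX him).contDiffAt (hU.mem_nhds hz)).differentiableAt one_ne_zero
  have hD : DifferentiableAt ℝ (fderiv ℝ X) z :=
    ((hX.fderiv_of_isOpen hU (m := 1) (by norm_num)).contDiffAt (hU.mem_nhds hz)).differentiableAt
      one_ne_zero
  have h := fderiv_inner_apply ℝ hN (hD.clm_apply (differentiableAt_const b)) a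
  simp only [inner_unitNormal_fderiv, fderiv_clm_apply hD (differentiableAt_const b)] at h
  simp at h
  linarith [real_inner_comm (unitNormal X z) (fderiv ℝ (fderiv ℝ X) z a b)]

/-- The denominator is `2 |X_u × X_v|²` by Lagrange's identity, nonzero for an immersion. -/
theorem meanCurvature_eq_zero_iff (h : Function.Injective (fderiv ℝ X z)) :
    meanCurvature X z = 0 ↔ secondForm X z 0 0 * firstForm X z 1 1
      - 2 * secondForm X z 0 1 * firstForm X z 0 1 + secondForm X z 1 1 * firstForm X z 0 0 = 0 := by
  rw [meanCurvature, div_eq_zero_iff, or_iff_left]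
  have h1 := inner_vecProd_self_add (partialD 0 X z) (partialD 1 X z)
  have h2 : (inner ℝ (vecProd (partialD 0 X z) (partialD 1 X z))
    (vecProd (partialD 0 X z) (partialD 1 X z)) : ℝ) ≠ 0 :=
      inner_self_ne_zero.2 (vecProd_partialD_ne_zero h)
  intro h3
  apply h2
  simp only [firstForm] at h3
  linarith

/-- On a surface of zero mean curvature, the form `N × dX` is closed. -/
theorem vecProd_fderiv_unitNormal_symm (hU : IsOpen U) (hX : ContDiffOn ℝ 2 X U)
    (him : ∀ z ∈ U, Function.Injective (fderiv ℝ X z)) (hz : z ∈ U)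
    (hH : meanCurvature X z = 0) (a b : Plane) :
    vecProd (fderiv ℝ (unitNormal X) z a) (fderiv ℝ X z b)
      = vecProd (fderiv ℝ (unitNormal X) z b) (fderiv ℝ X z a) := by
  have hsymm : fderiv ℝ (fderiv ℝ X) z (EuclideanSpace.single 1 1) (EuclideanSpace.single 0 1)
      = fderiv ℝ (fderiv ℝ X) z (EuclideanSpace.single 0 1) (EuclideanSpace.single 1 1) :=
    isSymmSndFDerivAt_of_contDiffOn hU hX hz _ _
  have key : vecProd (fderiv ℝ (unitNormal X) z (EuclideanSpace.single 0 1)) (partialD 1 X z)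
      = vecProd (fderiv ℝ (unitNormal X) z (EuclideanSpace.single 1 1)) (partialD 0 X z) := by
    refine vecProd_eq_vecProd_of_trace_eq_zero (n := unitNormal X z)
      (vecProd_partialD_ne_zero (him z hz)) (inner_unitNormal_self (him z hz))
      (inner_unitNormal_fderiv X z _) (inner_unitNormal_fderiv X z _)
      (inner_fderiv_unitNormal_self hU hX him hz _)
      (inner_fderiv_unitNormal_self hU hX him hz _) ?_
    have h := (meanCurvature_eq_zero_iff (him z hz)).1 hH
    simp only [secondForm, partialD_partialD hU hX hz, firstForm] at h
    have hd := inner_fderiv_unitNormal_add hU hX him hz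
    rw [partialD, partialD] at h ⊢
    rw [hd, hd, hd, hd, hsymm]
    linarith
  rw [map_plane_eq (fderiv ℝ (unitNormal X) z) a, map_plane_eq (fderiv ℝ (unitNormal X) z) b,
    fderiv_apply_eq_partialD X z a, fderiv_apply_eq_partialD X z b]
  simp only [vecProd_add, vecProd_smul, vecProd_add_left, vecProd_smul_left, key]
  module

/-! ### Conformal coordinates on a minimal surface -/

/-- The component along `u` of the one-form `N × dX` on a parametrized surface. -/
noncomputable def conjugateForm (X : Plane → Space) (u : Space) (z : Plane) : Plane →L[ℝ] ℝ :=
  (innerSL ℝ (vecProd u (unitNormal X z))).comp (fderiv ℝ X z)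

/-- The component along `u` of the complex one-form `dX - i N × dX` on a parametrized surface. -/
noncomputable def isotropicForm (X : Plane → Space) (u : Space) (z : Plane) : Plane →L[ℝ] ℂ :=
  Complex.ofRealCLM.comp ((innerSL ℝ u).comp (fderiv ℝ X z))
    - Complex.I • Complex.ofRealCLM.comp (conjugateForm X u z)

theorem conjugateForm_apply (u : Space) (z a : Plane) :
    conjugateForm X u z a = inner ℝ u (vecProd (unitNormal X z) (fderiv ℝ X z a)) := by
  simp only [conjugateForm, ContinuousLinearMap.comp_apply, innerSL_apply_apply, inner_vecProd_comm]

theorem isotropicForm_apply (u : Space) (z a : Plane) :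
    isotropicForm X u z a = (inner ℝ u (fderiv ℝ X z a) : ℝ)
      - Complex.I * (inner ℝ u (vecProd (unitNormal X z) (fderiv ℝ X z a)) : ℝ) := by
  rw [← conjugateForm_apply]
  rfl

theorem contDiffOn_vecProd_unitNormal (hU : IsOpen U) (hX : ContDiffOn ℝ 2 X U)
    (him : ∀ z ∈ U, Function.Injective (fderiv ℝ X z)) (u : Space) :
    ContDiffOn ℝ 1 (fun z => vecProd u (unitNormal X z)) U :=
  contDiff_vecProd.comp_contDiffOn (contDiffOn_const.prodMk (contDiffOn_unitNormal hU hX him))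

theorem contDiffOn_conjugateForm (hU : IsOpen U) (hX : ContDiffOn ℝ 2 X U)
    (him : ∀ z ∈ U, Function.Injective (fderiv ℝ X z)) (u : Space) :
    ContDiffOn ℝ 1 (conjugateForm X u) U :=
  ((innerSL ℝ).contDiff.comp_contDiffOn (contDiffOn_vecProd_unitNormal hU hX him u)).clm_comp
    (hX.fderiv_of_isOpen hU (by norm_num))

theorem continuousOn_isotropicForm (hU : IsOpen U) (hX : ContDiffOn ℝ 2 X U)
    (him : ∀ z ∈ U, Function.Injective (fderiv ℝ X z)) (u : Space) :
    ContinuousOn (isotropicForm X u) U := by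
  have h1 := (contDiffOn_conjugateForm hU hX him u).continuousOn
  have h2 : ContinuousOn (fderiv ℝ X) U := hX.continuousOn_fderiv_of_isOpen hU (by norm_num)
  have h3 : ContinuousOn (fun z => Complex.ofRealCLM.comp (conjugateForm X u z)) U :=
    continuousOn_const.clm_comp h1
  exact (continuousOn_const.clm_comp (continuousOn_const.clm_comp h2)).sub
    (h3.const_smul Complex.I)

/-- The derivative has two terms: one in `d²X`, symmetric by Schwarz, and one in `dN × dX`,
symmetric because the mean curvature vanishes. -/
theorem fderiv_conjugateForm_symm (hU : IsOpen U) (hX : ContDiffOn ℝ 2 X U)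
    (him : ∀ z ∈ U, Function.Injective (fderiv ℝ X z)) (hz : z ∈ U)
    (hH : meanCurvature X z = 0) (u : Space) (a b : Plane) :
    fderiv ℝ (conjugateForm X u) z a b = fderiv ℝ (conjugateForm X u) z b a := by
  have hN : DifferentiableAt ℝ (unitNormal X) z :=
    ((contDiffOn_unitNormal hU hX him).contDiffAt (hU.mem_nhds hz)).differentiableAt one_ne_zero
  have hD : DifferentiableAt ℝ (fderiv ℝ X) z :=
    ((hX.fderiv_of_isOpen hU (m := 1) (by norm_num)).contDiffAt (hU.mem_nhds hz)).differentiableAt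
      one_ne_zero
  have hC : DifferentiableAt ℝ (conjugateForm X u) z :=
    ((contDiffOn_conjugateForm hU hX him u).contDiffAt (hU.mem_nhds hz)).differentiableAt
      one_ne_zero
  have hV : HasFDerivAt (fun z => vecProd u (unitNormal X z))
      ((vecProdCLM u).comp (fderiv ℝ (unitNormal X) z)) z :=
    (vecProdCLM u).hasFDerivAt.comp z hN.hasFDerivAt
  have key (a b : Plane) : fderiv ℝ (conjugateForm X u) z a b =
      inner ℝ (vecProd u (unitNormal X z)) (fderiv ℝ (fderiv ℝ X) z a b)
        + inner ℝ u (vecProd (fderiv ℝ (unitNormal X) z a) (fderiv ℝ X z b)) := by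
    have h1 := fderiv_inner_apply ℝ hV.differentiableAt (hD.clm_apply (differentiableAt_const b)) a
    have h2 : fderiv ℝ (fun z => conjugateForm X u z b) z a
        = fderiv ℝ (conjugateForm X u) z a b := by
      rw [fderiv_clm_apply hC (differentiableAt_const b)]
      simp
    rw [← h2]
    refine h1.trans ?_
    rw [hV.fderiv, fderiv_clm_apply hD (differentiableAt_const b), ← inner_vecProd_comm]
    simp
  rw [key, key, vecProd_fderiv_unitNormal_symm hU hX him hz hH a b,
    isSymmSndFDerivAt_of_contDiffOn hU hX hz a b]

/-- On a convex domain, `dX - i N × dX` has a primitive, whose real part is `X`. -/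
theorem exists_hasFDerivAt_isotropicForm (hU : IsOpen U) (hUc : Convex ℝ U)
    (hX : ContDiffOn ℝ 2 X U) (him : ∀ z ∈ U, Function.Injective (fderiv ℝ X z))
    (hH : ∀ z ∈ U, meanCurvature X z = 0) (u : Space) :
    ∃ Φ : Plane → ℂ, ∀ z ∈ U, HasFDerivAt Φ (isotropicForm X u z) z
      ∧ (Φ z).re = inner ℝ u (X z) := by
  obtain ⟨Y, hY⟩ := hUc.exists_forall_hasFDerivAt_of_fderiv_symmetric hU
    ((contDiffOn_conjugateForm hU hX him u).differentiableOn one_ne_zero)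
    (fun z hz => fderiv_conjugateForm_symm hU hX him hz (hH z hz) u)
  refine ⟨fun z => Complex.ofRealCLM (innerSL ℝ u (X z)) - Complex.I • Complex.ofRealCLM (Y z),
    fun z hz => ⟨?_, by simp⟩⟩
  have hXz : HasFDerivAt X (fderiv ℝ X z) z :=
    ((hX.contDiffAt (hU.mem_nhds hz)).differentiableAt two_ne_zero).hasFDerivAt
  exact (Complex.ofRealCLM.hasFDerivAt.comp z ((innerSL ℝ u).hasFDerivAt.comp z hXz)).sub
    ((Complex.ofRealCLM.hasFDerivAt.comp z (hY z hz)).const_smul Complex.I)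

/-- Rotation by a right angle in the tangent plane multiplies the isotropic forms by `i`. -/
theorem exists_isotropicForm_eq_I_mul (h : Function.Injective (fderiv ℝ X z)) (a : Plane) :
    ∃ b, ∀ u, isotropicForm X u z b = Complex.I * isotropicForm X u z a := by
  have hN := inner_unitNormal_self h
  have ha := inner_unitNormal_fderiv X z a
  obtain ⟨b, hb⟩ := exists_fderiv_eq_of_inner_unitNormal h
    (w := vecProd (unitNormal X z) (fderiv ℝ X z a)) (by
      rw [← inner_vecProd_comm, vecProd_self, inner_zero_left])
  refine ⟨b, fun u => ?_⟩
  -- For tangent `w`, `N × (N × w) = -w`; so replacing `w` by `N × w` multiplies `⟨u, w⟩ - i ⟨u, N ×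
  -- w⟩` by `i`.
  rw [isotropicForm_apply, isotropicForm_apply, hb, vecProd_vecProd, hN, ha, zero_smul, one_smul,
    zero_sub, inner_neg_right, mul_sub, ← mul_assoc, Complex.I_mul_I]
  push_cast
  ring

/-- A vector of the kernel is sent by `dX` to a vector orthogonal to `v`, `N × v` and `N`, which
form an orthogonal frame because `v` is tangent. -/
theorem isotropicForm_injective (h : Function.Injective (fderiv ℝ X z)) {v : Space} (hv : v ≠ 0)
    (hvN : inner ℝ (unitNormal X z) v = (0 : ℝ)) : Function.Injective (isotropicForm X v z) := by
  rw [injective_iff_map_eq_zero]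
  intro a ha
  rw [isotropicForm_apply] at ha
  have h1 : inner ℝ v (fderiv ℝ X z a) = (0 : ℝ) := by
    simpa using congrArg Complex.re ha
  have h2 : inner ℝ v (vecProd (unitNormal X z) (fderiv ℝ X z a)) = (0 : ℝ) := by
    simpa using congrArg Complex.im ha
  have hN := inner_unitNormal_self h
  have hw := inner_unitNormal_fderiv X z a
  set w := fderiv ℝ X z a
  set n := unitNormal X z
  have hne : vecProd n v ≠ 0 := by
    intro h0
    have := inner_vecProd_self_add n v
    rw [h0, hN, hvN] at this
    simp only [real_inner_self_eq_norm_sq, inner_zero_left] at this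
    exact hv (norm_eq_zero.1 (by nlinarith))
  have key := smul_eq_of_inner_vecProd n v w
  have h3 : inner ℝ (vecProd n v) w = (0 : ℝ) := by
    rw [inner_vecProd_comm]
    rw [← inner_vecProd_comm] at h2
    rw [← neg_eq_zero, ← h2]
    simp only [inner_eq_sum_three, vecProd_zero_coord, vecProd_one_coord, vecProd_two_coord]
    ring
  rw [h1, hw, h3] at key
  have hw0 : w = 0 := by
    have : (inner ℝ (vecProd n v) (vecProd n v) : ℝ) • w = 0 := by rw [key]; simp
    exact (smul_eq_zero.1 this).resolve_left (inner_self_ne_zero.2 hne)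
  exact h (by rw [map_zero]; exact hw0)

/-- Near each point of a minimal surface, and for each nonzero tangent vector `v`, there are
conformal coordinates with `⟨v, X⟩` as their real part. In them, `X` is the real part of a
holomorphic map. -/
theorem exists_conformal_coordinates (hU : IsOpen U) (hX : ContDiffOn ℝ 2 X U)
    (him : ∀ z ∈ U, Function.Injective (fderiv ℝ X z)) (hH : ∀ z ∈ U, meanCurvature X z = 0)
    {x₀ : Plane} (hx₀ : x₀ ∈ U) {v : Space} (hv : v ≠ 0)
    (hvN : inner ℝ (unitNormal X x₀) v = (0 : ℝ)) :
    ∃ φ : OpenPartialHomeomorph Plane ℂ, x₀ ∈ φ.source ∧ φ.source ⊆ U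
      ∧ (∀ z ∈ φ.source, HasFDerivAt φ (isotropicForm X v z) z)
      ∧ ContDiffOn ℝ 1 φ.symm φ.target
      ∧ ∀ u : Space, ∃ h : ℂ → ℂ, DifferentiableOn ℂ h φ.target
        ∧ ∀ z ∈ φ.source, (h (φ z)).re = inner ℝ u (X z) := by
  obtain ⟨r, hr, hrU⟩ := Metric.isOpen_iff.1 hU x₀ hx₀
  set B := Metric.ball x₀ r
  have hB : IsOpen B := Metric.isOpen_ball
  have hΦ := exists_hasFDerivAt_isotropicForm hB (convex_ball x₀ r) (hX.mono hrU)
    (fun z hz => him z (hrU hz)) (fun z hz => hH z (hrU hz))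
  have hcont : ContinuousOn (isotropicForm X v) B :=
    (continuousOn_isotropicForm hU hX him v).mono hrU
  have hdim : Module.finrank ℝ Plane = Module.finrank ℝ ℂ := by simp
  obtain ⟨Z, hZ⟩ := hΦ v
  have hZc : ContDiffOn ℝ 1 Z B := by
    rw [show (1 : WithTop ℕ∞) = 0 + 1 from rfl, contDiffOn_succ_iff_fderiv_of_isOpen hB]
    refine ⟨fun z hz => (hZ z hz).1.differentiableAt.differentiableWithinAt, by simp, ?_⟩
    rw [contDiffOn_zero]
    exact hcont.congr fun z hz => (hZ z hz).1.fderiv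
  have hx₀B : x₀ ∈ B := Metric.mem_ball_self hr
  let E₀ : Plane ≃L[ℝ] ℂ := (LinearMap.linearEquivOfInjective (isotropicForm X v x₀).toLinearMap
    (isotropicForm_injective (him x₀ hx₀) hv hvN) hdim).toContinuousLinearEquiv
  have hE₀ : (E₀ : Plane →L[ℝ] ℂ) = isotropicForm X v x₀ := by
    ext a; rfl
  have hd₀ : HasFDerivAt Z (E₀ : Plane →L[ℝ] ℂ) x₀ := hE₀ ▸ (hZ x₀ hx₀B).1
  have hZ₀ : ContDiffAt ℝ 1 Z x₀ := hZc.contDiffAt (hB.mem_nhds hx₀B)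
  let φ₀ := hZ₀.toOpenPartialHomeomorph Z hd₀ one_ne_zero
  -- The inverse function theorem inverts the differential at `x₀` only; restricting to the open set
  -- where the form is invertible makes the inverse `C¹` on the whole target.
  let R : Set Plane := B ∩ isotropicForm X v ⁻¹' range ((↑) : (Plane ≃L[ℝ] ℂ) → (Plane →L[ℝ] ℂ))
  have hR : IsOpen R := hcont.isOpen_inter_preimage hB ContinuousLinearEquiv.isOpen
  have hsrc : (φ₀.restrOpen R hR).source = φ₀.source ∩ R := rfl
  have hd : ∀ z ∈ (φ₀.restrOpen R hR).source,
      HasFDerivAt (φ₀.restrOpen R hR) (isotropicForm X v z) z :=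
    fun z hz => (hZ z hz.2.1).1
  refine ⟨φ₀.restrOpen R hR, ⟨hZ₀.mem_toOpenPartialHomeomorph_source hd₀ one_ne_zero, hx₀B,
    ⟨E₀, hE₀⟩⟩, fun z hz => hrU hz.2.1, hd, ?_, ?_⟩
  · intro w hw
    have hz := (φ₀.restrOpen R hR).map_target hw
    obtain ⟨E, hE⟩ := hz.2.2
    refine ((φ₀.restrOpen R hR).contDiffAt_symm hw (f₀' := E) ?_ ?_).contDiffWithinAt
    · rw [hE]; exact hd _ hz
    · exact hZc.contDiffAt (hB.mem_nhds hz.2.1)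
  · intro u
    obtain ⟨Φ, hΦu⟩ := hΦ u
    refine ⟨Φ ∘ (φ₀.restrOpen R hR).symm, ?_, ?_⟩
    · intro w hw
      have hz := (φ₀.restrOpen R hR).map_target hw
      set z := (φ₀.restrOpen R hR).symm w
      obtain ⟨E, hE⟩ := hz.2.2
      have hsymm := (φ₀.restrOpen R hR).hasFDerivAt_symm (f' := E) hw
        (by rw [hE]; exact hd _ hz)
      have hcomp := (hΦu z hz.2.1).1.comp w hsymm
      refine (differentiableAt_complex_iff_differentiableAt_real.2
        ⟨hcomp.differentiableAt, ?_⟩).differentiableWithinAt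
      rw [hcomp.fderiv]
      -- Cauchy-Riemann: the quarter turn in the tangent plane acts as `i` on the forms of all `u`
      -- at once, in particular on that of `v`, which is the differential of the coordinate.
      obtain ⟨b, hb⟩ := exists_isotropicForm_eq_I_mul (him z (hrU hz.2.1)) (E.symm 1)
      have hbE : E.symm Complex.I = b := by
        rw [ContinuousLinearEquiv.symm_apply_eq]
        have := hb v
        rw [← hE] at this
        simpa using this.symm
      simp only [ContinuousLinearMap.comp_apply, ContinuousLinearEquiv.coe_coe, hbE, hb u,
        smul_eq_mul]
    · intro z hz
      rw [Function.comp_apply, (φ₀.restrOpen R hR).left_inv hz]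
      exact (hΦu z hz.2.1).2

/-- The velocity of a curve that `X` maps to a parametrized line. -/
theorem fderiv_deriv_eq_of_eventually_eq_line {β : ℝ → Plane} {t : ℝ} {p v : Space}
    (hX : DifferentiableAt ℝ X (β t)) (hβ : DifferentiableAt ℝ β t)
    (h : ∀ᶠ s in 𝓝 t, X (β s) = p + s • v) : fderiv ℝ X (β t) (deriv β t) = v := by
  have h1 : HasDerivAt (X ∘ β) (fderiv ℝ X (β t) (deriv β t)) t :=
    hX.hasFDerivAt.comp_hasDerivAt t hβ.hasDerivAt
  have h2 : HasDerivAt (fun s : ℝ => p + s • v) v t := by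
    simpa using ((hasDerivAt_id t).smul_const v).const_add p
  exact h1.unique (h2.congr_of_eventuallyEq h)

/-- On a minimal surface near a point where `v` is tangent, any curve lying over a line of
direction `v` extends for a uniform time as a curve lying over that line. -/
theorem exists_line_lift (hU : IsOpen U) (hX : ContDiffOn ℝ 2 X U)
    (him : ∀ z ∈ U, Function.Injective (fderiv ℝ X z)) (hH : ∀ z ∈ U, meanCurvature X z = 0)
    {x₀ : Plane} (hx₀ : x₀ ∈ U) {v : Space} (hv : ‖v‖ = 1)
    (hvN : inner ℝ (unitNormal X x₀) v = (0 : ℝ)) :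
    ∃ r > 0, ∃ V ∈ 𝓝 x₀, ∀ (β : ℝ → Plane) (t₀ : ℝ) (p : Space), β t₀ ∈ V →
      (∀ᶠ t in 𝓝 t₀, DifferentiableAt ℝ β t ∧ X (β t) = p + t • v) →
      ∃ δ : ℝ → Plane, ContDiffOn ℝ 1 δ (Ioo (t₀ - r) (t₀ + r)) ∧
        (∀ t ∈ Ioo (t₀ - r) (t₀ + r), δ t ∈ U ∧ X (δ t) = p + t • v) ∧ δ =ᶠ[𝓝 t₀] β := by
  have hv0 : v ≠ 0 := by
    rintro rfl
    simp at hv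
  obtain ⟨φ, hxφ, hφU, hφd, hφs, hφh⟩ := exists_conformal_coordinates hU hX him hH hx₀ hv0 hvN
  obtain ⟨R, hR, hRt⟩ := Metric.isOpen_iff.1 φ.open_target (φ x₀) (φ.map_source hxφ)
  have hVo : IsOpen (φ.source ∩ φ ⁻¹' Metric.ball (φ x₀) (R / 2)) :=
    φ.isOpen_inter_preimage Metric.isOpen_ball
  -- From a point within `R / 2` of the centre, a horizontal segment of length less than `R / 2`
  -- stays in the disc of radius `R`.
  refine ⟨R / 2, half_pos hR, φ.source ∩ φ ⁻¹' Metric.ball (φ x₀) (R / 2),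
    hVo.mem_nhds ⟨hxφ, Metric.mem_ball_self (half_pos hR)⟩, fun β t₀ p hβV hβ => ?_⟩
  set r := R / 2
  set w₀ := φ (β t₀)
  let ℓ : ℝ → ℂ := fun t => w₀ + ((t - t₀ : ℝ) : ℂ)
  have hℓt : ∀ t ∈ Ioo (t₀ - r) (t₀ + r), ℓ t ∈ φ.target := by
    intro t ht
    apply hRt
    have h1 : dist w₀ (φ x₀) < r := hβV.2
    have h2 : dist (ℓ t) w₀ < r := by
      rw [dist_eq_norm, add_sub_cancel_left, Complex.norm_real, Real.norm_eq_abs, abs_lt]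
      constructor <;> linarith [ht.1, ht.2]
    have h3 := dist_triangle (ℓ t) w₀ (φ x₀)
    rw [Metric.mem_ball]
    have : R = r + r := by simp [r]
    linarith
  have hℓc : ContDiff ℝ 1 ℓ := by
    have : ContDiff ℝ 1 fun t : ℝ => t - t₀ := by fun_prop
    exact contDiff_const.add (Complex.ofRealCLM.contDiff.comp this)
  -- The derivative of `φ ∘ β` is the form at a vector sent to `v`, that is `|v|² - i ⟨v, N × v⟩ =
  -- 1`; so `φ (β t) - t` is locally constant.
  have hδβ : (φ.symm ∘ ℓ) =ᶠ[𝓝 t₀] β := by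
    have hβc : ContinuousAt β t₀ := hβ.self_of_nhds.1.continuousAt
    have hev : ∀ᶠ t in 𝓝 t₀, β t ∈ φ.source ∧ HasDerivAt (fun t => φ (β t) - (t : ℂ)) 0 t := by
      filter_upwards [hβc.preimage_mem_nhds (hVo.mem_nhds hβV), hβ.eventually_nhds] with t ht hbt
      refine ⟨ht.1, ?_⟩
      have hXt : DifferentiableAt ℝ X (β t) :=
        (hX.contDiffAt (hU.mem_nhds (hφU ht.1))).differentiableAt two_ne_zero
      have hvel := fderiv_deriv_eq_of_eventually_eq_line hXt hbt.self_of_nhds.1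
        (hbt.mono fun s hs => hs.2)
      have h1 := (hφd _ ht.1).comp_hasDerivAt t hbt.self_of_nhds.1.hasDerivAt
      have h2 : isotropicForm X v (β t) (deriv β t) = 1 := by
        rw [isotropicForm_apply, hvel, real_inner_self_eq_norm_sq, hv,
          real_inner_comm (vecProd _ v) v, inner_vecProd_comm, vecProd_self]
        simp
      rw [h2] at h1
      have h3 := h1.sub (Complex.ofRealCLM.hasDerivAt (x := t))
      rw [Complex.ofRealCLM_apply, Complex.ofReal_one, sub_self] at h3
      exact h3
    obtain ⟨ε, hε, hball⟩ := Metric.eventually_nhds_iff_ball.1 hev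
    filter_upwards [Metric.ball_mem_nhds t₀ hε] with t ht
    have hconst := Metric.isOpen_ball.is_const_of_deriv_eq_zero
      (convex_ball t₀ ε).isPreconnected
      (fun s hs => (hball s hs).2.differentiableAt.differentiableWithinAt)
      (fun s hs => (hball s hs).2.deriv) ht (Metric.mem_ball_self hε)
    have : ℓ t = φ (β t) := by
      simp only [ℓ, w₀]
      push_cast
      linear_combination -hconst
    rw [Function.comp_apply, this, φ.left_inv (hball t ht).1]
  refine ⟨φ.symm ∘ ℓ, hφs.comp hℓc.contDiffOn hℓt, fun t ht => ?_, hδβ⟩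
  refine ⟨hφU (φ.map_target (hℓt t ht)), ?_⟩
  -- Each component of `X` along the horizontal segment is real analytic in `t` and agrees near `t₀`
  -- with an affine function, hence on the whole interval.
  refine ext_inner_left ℝ fun u => ?_
  obtain ⟨h, hh, hhX⟩ := hφh u
  have hF : AnalyticOnNhd ℝ (fun t => (h (ℓ t)).re) (Ioo (t₀ - r) (t₀ + r)) := by
    intro s hs
    have h1 : AnalyticAt ℝ h (ℓ s) :=
      ((hh.analyticOnNhd φ.open_target) _ (hℓt s hs)).restrictScalars
    have h2 : AnalyticAt ℝ ℓ s := by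
      have : AnalyticAt ℝ (fun t : ℝ => t - t₀) s := analyticAt_id.sub analyticAt_const
      exact analyticAt_const.add ((Complex.ofRealCLM.analyticAt _).comp this)
    exact (Complex.reCLM.analyticAt _).comp (h1.comp h2)
  have hG : AnalyticOnNhd ℝ (fun t : ℝ => (inner ℝ u p + t * inner ℝ u v : ℝ))
      (Ioo (t₀ - r) (t₀ + r)) :=
    fun s _ => analyticAt_const.add (analyticAt_id.mul analyticAt_const)
  have heq : (fun t => (h (ℓ t)).re) =ᶠ[𝓝 t₀] fun t : ℝ => (inner ℝ u p + t * inner ℝ u v : ℝ) := by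
    have hr : 0 < r := half_pos hR
    filter_upwards [hδβ, hβ, Ioo_mem_nhds (by linarith : t₀ - r < t₀) (by linarith : t₀ < t₀ + r)]
      with s hs hbs hsI
    have h1 := hhX _ (φ.map_target (hℓt s hsI))
    rw [φ.right_inv (hℓt s hsI)] at h1
    rw [h1, show φ.symm (ℓ s) = β s from hs, hbs.2, inner_add_right, inner_smul_right]
  have hr : 0 < r := half_pos hR
  have hall := hF.eqOn_of_preconnected_of_eventuallyEq hG isPreconnected_Ioo
    (⟨by linarith, by linarith⟩ : t₀ ∈ Ioo (t₀ - r) (t₀ + r)) heq ht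
  have h1 := hhX _ (φ.map_target (hℓt t ht))
  rw [φ.right_inv (hℓt t ht)] at h1
  rw [inner_add_right, inner_smul_right]
  exact h1.symm.trans hall

end Parametrized

/-! ### Curves on an immersed surface lying over a line -/

section Lifts

variable {S : Type*} [TopologicalSpace S] [ChartedSpace Plane S] {f : S → Space}

/-- The curve `γ` of `S` is of class `C¹` on `s` and lies over the line `t ↦ p + t • v`. -/
structure IsLineLift (f : S → Space) (p v : Space) (γ : ℝ → S) (s : Set ℝ) : Prop where
  contMDiffOn : ContMDiffOn 𝓘(ℝ, ℝ) (𝓡 2) 1 γ s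
  apply_eq : ∀ t ∈ s, f (γ t) = p + t • v

theorem IsLineLift.mono {p v : Space} {γ : ℝ → S} {s t : Set ℝ} (h : IsLineLift f p v γ s)
    (hts : t ⊆ s) : IsLineLift f p v γ t :=
  ⟨h.contMDiffOn.mono hts, fun x hx => h.apply_eq x (hts hx)⟩

theorem IsLineLift.comp_neg {p v : Space} {γ : ℝ → S} {s : Set ℝ} (h : IsLineLift f p v γ s) :
    IsLineLift f p (-v) (fun t => γ (-t)) (Neg.neg ⁻¹' s) where
  contMDiffOn := h.contMDiffOn.comp (contDiff_neg.contMDiff.contMDiffOn) fun _ ht => ht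
  apply_eq t ht := by
    rw [h.apply_eq (-t) ht]
    simp

/-- Curves over a line of unit speed have the expected length. -/
theorem IsLineLift.intrinsicEDist_le {p v : Space} (hv : ‖v‖ = 1) {γ : ℝ → S} {a b : ℝ}
    (hab : a ≤ b) (h : IsLineLift f p v γ (Icc a b)) :
    intrinsicEDist f (γ a) (γ b) ≤ ENNReal.ofReal (b - a) := by
  have hle : intrinsicEDist f (γ a) (γ b)
      ≤ ∫⁻ t in Icc a b, ‖derivWithin (f ∘ γ) (Icc a b) t‖ₑ :=
    sInf_le ⟨a, b, γ, hab, h.contMDiffOn, rfl, rfl, rfl⟩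
  refine hle.trans ?_
  rcases hab.eq_or_lt with rfl | hab
  · simp
  have hd : ∀ t ∈ Icc a b, ‖derivWithin (f ∘ γ) (Icc a b) t‖ₑ = 1 := by
    intro t ht
    have h1 : HasDerivWithinAt (fun s : ℝ => p + s • v) v (Icc a b) t := by
      simpa using (((hasDerivAt_id t).smul_const v).const_add p).hasDerivWithinAt
    have h2 : HasDerivWithinAt (f ∘ γ) v (Icc a b) t :=
      h1.congr (fun s hs => h.apply_eq s hs) (h.apply_eq t ht)
    rw [h2.derivWithin (uniqueDiffOn_Icc hab t ht), ← ofReal_norm, hv, ENNReal.ofReal_one]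
  rw [setLIntegral_congr_fun measurableSet_Icc hd]
  simp

theorem IsLineLift.intrinsicEDist_le_abs {p v : Space} (hv : ‖v‖ = 1) {γ : ℝ → S} {s : Set ℝ}
    (hs : s.OrdConnected) (h : IsLineLift f p v γ s) {a b : ℝ} (ha : a ∈ s) (hb : b ∈ s) :
    intrinsicEDist f (γ a) (γ b) ≤ ENNReal.ofReal |b - a| := by
  rcases le_total a b with hab | hab
  · rw [abs_of_nonneg (sub_nonneg.2 hab)]
    exact (h.mono (hs.out ha hb)).intrinsicEDist_le hv hab
  · have h1 : IsLineLift f p (-v) (fun t => γ (-t)) (Icc (-a) (-b)) :=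
      h.comp_neg.mono fun t ht => hs.out hb ha ⟨by linarith [ht.2], by linarith [ht.1]⟩
    have h2 := h1.intrinsicEDist_le (by rwa [norm_neg]) (neg_le_neg hab)
    simp only [neg_neg] at h2
    rw [abs_of_nonpos (sub_nonpos.2 hab)]
    convert h2 using 2
    ring

/-- Uniqueness of lifts: the coincidence set is closed because `S` is Hausdorff, and open because
`f` is locally injective. -/
theorem IsLineLift.eqOn [T2Space S] (hf : IsLocallyInjective f) {p v : Space} {γ γ' : ℝ → S}
    {a b c : ℝ} (h : IsLineLift f p v γ (Ioo a b)) (h' : IsLineLift f p v γ' (Ioo a b))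
    (hc : c ∈ Ioo a b) (hγ : γ c = γ' c) : EqOn γ γ' (Ioo a b) :=
  (T2Space.isSeparatedMap f).eqOn_of_comp_eqOn hf isPreconnected_Ioo h.contMDiffOn.continuousOn
    h'.contMDiffOn.continuousOn
    (fun t ht => (h.apply_eq t ht).trans (h'.apply_eq t ht).symm) hc hγ

variable [IsManifold (𝓡 2) 2 S]

/-! ### Charts -/

theorem IsMinimalImmersion.contDiffOn_chart (hf : IsMinimalImmersion f) (x : S) :
    ContDiffOn ℝ 2 (f ∘ (chartAt Plane x).symm) (chartAt Plane x).target :=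
  (hf.contMDiff.comp_contMDiffOn (contMDiffOn_chart_symm (I := 𝓡 2) (x := x))).contDiffOn

theorem IsMinimalImmersion.fderiv_chart_injective (hf : IsMinimalImmersion f) (x : S) {z : Plane}
    (hz : z ∈ (chartAt Plane x).target) :
    Function.Injective (fderiv ℝ (f ∘ (chartAt Plane x).symm) z) := by
  have : IsManifold (𝓡 2) 1 S := IsManifold.of_le (n := 2) (by norm_num)
  have he := (mdifferentiable_chart (I := 𝓡 2) x).symm
  have h1 := he.mfderiv_injective (x := z) hz
  have h2 := hf.injective_mfderiv ((chartAt Plane x).symm z)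
  rw [← mfderiv_eq_fderiv, mfderiv_comp z (hf.contMDiff.mdifferentiableAt two_ne_zero)
    (he.mdifferentiableAt hz)]
  exact h2.comp h1

theorem IsMinimalImmersion.meanCurvature_chart (hf : IsMinimalImmersion f) (x : S) {z : Plane}
    (hz : z ∈ (chartAt Plane x).target) : meanCurvature (f ∘ (chartAt Plane x).symm) z = 0 := by
  have := hf.meanCurvature_eq_zero _ (IsManifold.chart_mem_maximalAtlas x) _
    ((chartAt Plane x).map_target hz)
  rwa [(chartAt Plane x).right_inv hz] at this

/-- An immersion has local left inverses of class `C¹`. -/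
theorem IsMinimalImmersion.exists_local_leftInverse (hf : IsMinimalImmersion f) (x : S) :
    ∃ V ∈ 𝓝 x, ∃ (W : Set Space) (g : Space → S), MapsTo f V W ∧
      ContMDiffOn 𝓘(ℝ, Space) (𝓡 2) 1 g W ∧ ∀ y ∈ V, g (f y) = y := by
  have : IsManifold (𝓡 2) 1 S := IsManifold.of_le (n := 2) (by norm_num)
  set e := chartAt Plane x
  set X := f ∘ e.symm
  have hx : e x ∈ e.target := mem_chart_target Plane x
  have hX : ContDiffAt ℝ 2 X (e x) := (hf.contDiffOn_chart x).contDiffAt (e.open_target.mem_nhds hx)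
  -- Composing with a linear left inverse of the differential gives a map of the plane whose
  -- derivative at `e x` is the identity, to which the inverse function theorem applies.
  obtain ⟨L, hL⟩ := (fderiv ℝ X (e x)).toLinearMap.exists_leftInverse_of_injective
    (LinearMap.ker_eq_bot.2 (hf.fderiv_chart_injective x hx))
  set L' : Space →L[ℝ] Plane := L.toContinuousLinearMap
  have hh : ContDiffAt ℝ 1 (L' ∘ X) (e x) :=
    L'.contDiff.contDiffAt.comp _ (hX.of_le (by norm_num))
  have hd : HasFDerivAt (L' ∘ X) ((ContinuousLinearEquiv.refl ℝ Plane : Plane ≃L[ℝ] Plane) :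
      Plane →L[ℝ] Plane) (e x) := by
    have h1 := L'.hasFDerivAt.comp (e x) (hX.differentiableAt two_ne_zero).hasFDerivAt
    have h2 : ((ContinuousLinearEquiv.refl ℝ Plane : Plane ≃L[ℝ] Plane) : Plane →L[ℝ] Plane)
        = L'.comp (fderiv ℝ X (e x)) := by
      ext1 a
      exact (LinearMap.congr_fun hL a).symm
    rw [h2]
    exact h1
  let φ := hh.toOpenPartialHomeomorph (L' ∘ X) hd one_ne_zero
  have hxφ : e x ∈ φ.source := hh.mem_toOpenPartialHomeomorph_source hd one_ne_zero
  have hψ : ContDiffAt ℝ 1 φ.symm ((L' ∘ X) (e x)) := hh.to_localInverse hd one_ne_zero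
  obtain ⟨u, hu, hψu⟩ := hψ.contDiffOn le_rfl (by simp)
  have hfx : (L' ∘ X) (e x) = L' (f x) := by
    simp [X, e]
  refine ⟨e.source ∩ e ⁻¹' φ.source ∩ (fun y => L' (f y)) ⁻¹' u, ?_,
    {w | L' w ∈ u ∧ φ.symm (L' w) ∈ e.target}, fun w => e.symm (φ.symm (L' w)), ?_, ?_, ?_⟩
  · refine inter_mem ((e.isOpen_inter_preimage φ.open_source).mem_nhds
      ⟨mem_chart_source Plane x, hxφ⟩) ?_
    have : Continuous fun y => L' (f y) := L'.continuous.comp hf.contMDiff.continuous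
    exact this.continuousAt.preimage_mem_nhds (hfx ▸ hu)
  · rintro y ⟨⟨hy, hyφ⟩, hyu⟩
    have h1 : L' (f y) = φ (e y) := by
      change _ = L' (f (e.symm (e y)))
      rw [e.left_inv hy]
    refine ⟨hyu, ?_⟩
    rw [h1, φ.left_inv hyφ]
    exact e.map_source hy
  · have h1 : ContDiffOn ℝ 1 (fun w => φ.symm (L' w))
        {w | L' w ∈ u ∧ φ.symm (L' w) ∈ e.target} :=
      hψu.comp L'.contDiff.contDiffOn fun w hw => hw.1
    exact (contMDiffOn_chart_symm (I := 𝓡 2) (x := x)).comp h1.contMDiffOn fun w hw => hw.2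
  · rintro y ⟨⟨hy, hyφ⟩, hyu⟩
    have h1 : L' (f y) = φ (e y) := by
      change _ = L' (f (e.symm (e y)))
      rw [e.left_inv hy]
    simp only [h1, φ.left_inv hyφ, e.left_inv hy]

theorem IsMinimalImmersion.isLocallyInjective (hf : IsMinimalImmersion f) :
    IsLocallyInjective f := by
  rw [isLocallyInjective_iff_nhds]
  intro x
  obtain ⟨V, hV, W, g, -, -, hg⟩ := hf.exists_local_leftInverse x
  exact ⟨V, hV, fun a ha b hb hab => by rw [← hg a ha, ← hg b hb, hab]⟩

/-! ### Existence and continuation of lifts of the line -/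

/-- Baire's theorem yields a curve of the surface over some part of a segment of its image. -/
theorem IsMinimalImmersion.exists_isLineLift [SecondCountableTopology S]
    (hf : IsMinimalImmersion f) {p v : Space} {l : ℝ} (hl : 0 < l)
    (hseg : ∀ t ∈ Icc 0 l, p + t • v ∈ range f) :
    ∃ (a b : ℝ) (γ : ℝ → S), a < b ∧ IsLineLift f p v γ (Ioo a b) := by
  have : LocallyCompactSpace S := ChartedSpace.locallyCompactSpace Plane S
  choose V hV W g hfW hg hgf using hf.exists_local_leftInverse
  choose K hK hKV hKc using fun x => LocallyCompactSpace.local_compact_nhds x (V x) (hV x)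
  obtain ⟨s, hs, hsK⟩ := TopologicalSpace.countable_cover_nhds hK
  have hτ : Continuous fun t : ℝ => p + t • v := by fun_prop
  -- The half-lines `Iic 0 ∪ Ici l` are added so that countably many closed sets cover all of `ℝ`;
  -- an interior point chosen in `(0, l)` avoids them.
  have hclosed : ∀ x ∈ s, IsClosed ((fun t : ℝ => p + t • v) ⁻¹' (f '' K x) ∪ (Iic 0 ∪ Ici l)) :=
    fun x _ => ((((hKc x).image hf.contMDiff.continuous).isClosed).preimage hτ).union
      (isClosed_Iic.union isClosed_Ici)
  have hcover : ⋃ x ∈ s, ((fun t : ℝ => p + t • v) ⁻¹' (f '' K x) ∪ (Iic 0 ∪ Ici l)) = univ := by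
    refine eq_univ_of_forall fun t => ?_
    have hmem (y : S) : ∃ x ∈ s, y ∈ K x := by simpa using hsK.ge (mem_univ y)
    by_cases ht : t ∈ Icc 0 l
    · obtain ⟨y, hy⟩ := hseg t ht
      obtain ⟨x, hx, hyx⟩ := hmem y
      exact mem_biUnion hx (Or.inl ⟨y, hyx, hy⟩)
    · obtain ⟨y, -⟩ := hseg 0 ⟨le_rfl, hl.le⟩
      obtain ⟨x, hx, -⟩ := hmem y
      refine mem_biUnion hx (Or.inr ?_)
      simp only [mem_Icc, not_and_or, not_le] at ht
      exact ht.imp le_of_lt le_of_lt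
  obtain ⟨t, ht, htx⟩ := (dense_biUnion_interior_of_closed hclosed hs hcover).exists_mem_open
    isOpen_Ioo (nonempty_Ioo.2 hl)
  obtain ⟨x, hx, hxt⟩ := mem_iUnion₂.1 ht
  obtain ⟨ε, hε, hball⟩ := Metric.isOpen_iff.1 (isOpen_interior.inter isOpen_Ioo) t ⟨hxt, htx⟩
  rw [Real.ball_eq_Ioo] at hball
  have hlift : ∀ r ∈ Ioo (t - ε) (t + ε), ∃ y ∈ K x, f y = p + r • v := by
    intro r hr
    have h1 := hball hr
    rcases interior_subset h1.1 with h2 | h2 | h2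
    · exact h2
    · exact absurd h1.2.1 (not_lt.2 h2)
    · exact absurd h1.2.2 (not_lt.2 h2)
  refine ⟨t - ε, t + ε, fun r => g x (p + r • v), by linarith, ?_, fun r hr => ?_⟩
  · have : ContDiff ℝ 1 fun r : ℝ => p + r • v := by fun_prop
    refine (hg x).comp this.contMDiff.contMDiffOn fun r hr => ?_
    obtain ⟨y, hy, hyr⟩ := hlift r hr
    rw [mem_preimage, ← hyr]
    exact hfW x (hKV x hy)
  · obtain ⟨y, hy, hyr⟩ := hlift r hr
    rw [← hyr, hgf x y (hKV x hy)]

/-- A curve over a line extends beyond any of its limit points. -/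
theorem IsMinimalImmersion.exists_extension_of_tendsto (hf : IsMinimalImmersion f) {p v : Space}
    (hv : ‖v‖ = 1) {γ : ℝ → S} {a T c : ℝ} (hγ : IsLineLift f p v γ (Ioo a T)) (hc : c < T)
    {u : ℕ → ℝ} (hu : ∀ n, u n ∈ Ioo a T) (huT : Tendsto u atTop (𝓝 T)) {y : S}
    (hy : Tendsto (fun n => γ (u n)) atTop (𝓝 y)) :
    ∃ T' > T, ∃ s > c, ∃ γ' : ℝ → S, IsLineLift f p v γ' (Ioo a T') ∧ EqOn γ' γ (Iio s) := by
  have : IsManifold (𝓡 2) 1 S := IsManifold.of_le (n := 2) (by norm_num)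
  set e := chartAt Plane y
  set X := f ∘ e.symm
  have hX : ContDiffOn ℝ 2 X e.target := hf.contDiffOn_chart y
  have him : ∀ z ∈ e.target, Function.Injective (fderiv ℝ X z) :=
    fun z hz => hf.fderiv_chart_injective y hz
  have hy₀ : e y ∈ e.target := mem_chart_target Plane y
  have hcurve : ∀ t ∈ Ioo a T, γ t ∈ e.source →
      ∀ᶠ r in 𝓝 t, DifferentiableAt ℝ (e ∘ γ) r ∧ X ((e ∘ γ) r) = p + r • v := by
    intro t ht hts
    have h1 : ContinuousAt γ t := hγ.contMDiffOn.continuousOn.continuousAt (isOpen_Ioo.mem_nhds ht)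
    filter_upwards [h1.preimage_mem_nhds (e.open_source.mem_nhds hts), isOpen_Ioo.mem_nhds ht]
      with r hr hrI
    constructor
    · have h2 : MDifferentiableAt 𝓘(ℝ, ℝ) (𝓡 2) γ r :=
        (hγ.contMDiffOn.contMDiffAt (isOpen_Ioo.mem_nhds hrI)).mdifferentiableAt one_ne_zero
      have h3 : MDifferentiableAt (𝓡 2) (𝓡 2) e (γ r) :=
        (mdifferentiable_chart (I := 𝓡 2) y).mdifferentiableAt hr
      exact (h3.comp r h2).differentiableAt
    · simp only [X, Function.comp_apply]
      rw [e.left_inv hr, hγ.apply_eq r hrI]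
  have hsrc : ∀ᶠ n in atTop, γ (u n) ∈ e.source :=
    hy.eventually (e.open_source.mem_nhds (mem_chart_source Plane y))
  have hey : Tendsto (fun n => e (γ (u n))) atTop (𝓝 (e y)) :=
    (e.continuousAt (mem_chart_source Plane y)).tendsto.comp hy
  -- At each `γ (u n)` the vector `v` is the velocity of the lift, hence tangent; this passes to the
  -- limit by continuity of the normal.
  have hvN : inner ℝ (unitNormal X (e y)) v = (0 : ℝ) := by
    have h1 : ContinuousAt (unitNormal X) (e y) :=
      (contDiffOn_unitNormal e.open_target hX him).continuousOn.continuousAt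
        (e.open_target.mem_nhds hy₀)
    have h2 : Tendsto (fun n => (inner ℝ (unitNormal X (e (γ (u n)))) v : ℝ)) atTop
        (𝓝 (inner ℝ (unitNormal X (e y)) v)) :=
      (h1.tendsto.comp hey).inner tendsto_const_nhds
    refine tendsto_nhds_unique (h2.congr' ?_) tendsto_const_nhds
    filter_upwards [hsrc] with n hn
    have h3 := hcurve (u n) (hu n) hn
    have h4 := fderiv_deriv_eq_of_eventually_eq_line (X := X) (β := e ∘ γ) (t := u n)
      ((hX.contDiffAt (e.open_target.mem_nhds (e.map_source hn))).differentiableAt two_ne_zero)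
      h3.self_of_nhds.1 (h3.mono fun r hr => hr.2)
    rw [← h4]
    exact inner_unitNormal_fderiv X _ _
  obtain ⟨r, hr, V, hV, hlift⟩ := exists_line_lift e.open_target hX him
    (fun z hz => hf.meanCurvature_chart y hz) hy₀ hv hvN
  -- As `r` does not depend on `n`, a parameter `u n > T - r` gives a lift reaching `u n + r > T`.
  obtain ⟨n, hn, hnV, hnT, hnc⟩ := (hsrc.and ((hey.eventually hV).and
    ((huT.eventually (lt_mem_nhds (show T - r < T by linarith))).and
      (huT.eventually (lt_mem_nhds hc))))).exists
  set t₀ := u n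
  obtain ⟨δ, hδ, hδX, hδγ⟩ := hlift (e ∘ γ) t₀ p hnV (hcurve t₀ (hu n) hn)
  have hδγ' : (fun t => e.symm (δ t)) =ᶠ[𝓝 t₀] γ := by
    have h1 : ContinuousAt γ t₀ :=
      hγ.contMDiffOn.continuousOn.continuousAt (isOpen_Ioo.mem_nhds (hu n))
    filter_upwards [hδγ, h1.preimage_mem_nhds (e.open_source.mem_nhds hn)] with t ht hts
    rw [ht, Function.comp_apply, e.left_inv hts]
  have hδlift : IsLineLift f p v (fun t => e.symm (δ t)) (Ioo (t₀ - r) (t₀ + r)) :=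
    ⟨(contMDiffOn_chart_symm (I := 𝓡 2) (x := y)).comp hδ.contMDiffOn fun t ht => (hδX t ht).1,
      fun t ht => (hδX t ht).2⟩
  -- The two pieces coincide in a neighbourhood of `t₀`, so the glued curve is `C¹` there.
  set γ' : ℝ → S := fun t => if t < t₀ then γ t else e.symm (δ t)
  have hlt : ∀ t < t₀, γ' t = γ t := fun t ht => if_pos ht
  have hge : ∀ t, t₀ ≤ t → γ' t = e.symm (δ t) := fun t ht => if_neg (not_lt.2 ht)
  refine ⟨t₀ + r, by linarith, t₀, hnc, γ', ⟨fun t ht => ?_, fun t ht => ?_⟩, fun t ht => hlt t ht⟩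
  · refine ContMDiffAt.contMDiffWithinAt ?_
    rcases lt_or_ge t t₀ with h | h
    · refine (hγ.contMDiffOn.contMDiffAt
        (isOpen_Ioo.mem_nhds ⟨ht.1, h.trans (hu n).2⟩)).congr_of_eventuallyEq ?_
      filter_upwards [Iio_mem_nhds h] with w hw using hlt w hw
    · refine (hδlift.contMDiffOn.contMDiffAt
        (isOpen_Ioo.mem_nhds ⟨by linarith, ht.2⟩)).congr_of_eventuallyEq ?_
      rcases h.eq_or_lt with rfl | h
      · filter_upwards [hδγ'] with w hw
        rcases lt_or_ge w t₀ with h' | h'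
        · rw [hlt w h', hw]
        · exact hge w h'
      · filter_upwards [Ioi_mem_nhds h] with w hw using hge w (le_of_lt hw)
  · rcases lt_or_ge t t₀ with h | h
    · rw [hlt t h]
      exact hγ.apply_eq t ⟨ht.1, h.trans (hu n).2⟩
    · rw [hge t h]
      exact hδlift.apply_eq t ⟨by linarith, ht.2⟩

/-- On a complete minimal surface, curves over a line extend indefinitely. -/
theorem IsMinimalImmersion.exists_isLineLift_Ioo [T2Space S] (hf : IsMinimalImmersion f)
    (hcomplete : IsCompleteSurface f) {p v : Space} (hv : ‖v‖ = 1) {γ : ℝ → S} {a b : ℝ}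
    (hab : a < b) (hγ : IsLineLift f p v γ (Ioo a b)) (t : ℝ) :
    ∃ T > t, ∃ γ' : ℝ → S, IsLineLift f p v γ' (Ioo a T) := by
  by_contra! hcon
  obtain ⟨c, hac, hcb⟩ := exists_between hab
  -- Fixing the value at `c` makes any two of these lifts agree on their common interval.
  set A := {T | b ≤ T ∧ ∃ γ' : ℝ → S, IsLineLift f p v γ' (Ioo a T) ∧ γ' c = γ c}
  have hbA : b ∈ A := ⟨le_rfl, γ, hγ, rfl⟩
  have hA : BddAbove A := by
    refine ⟨t, fun T hT => ?_⟩
    by_contra! hlt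
    obtain ⟨-, γ', hγ', -⟩ := hT
    exact hcon T hlt γ' hγ'
  set T := sSup A
  have hbT : b ≤ T := le_csSup hA hbA
  -- The condition `s < T` sits inside the existential so that the choice is total; for `s ≥ T` the
  -- values are arbitrary.
  have hex : ∀ s, ∃ (T' : ℝ) (γ' : ℝ → S), s < T → s < T' ∧ b ≤ T' ∧
      IsLineLift f p v γ' (Ioo a T') ∧ γ' c = γ c := by
    intro s
    by_cases hs : s < T
    · obtain ⟨T', ⟨hbT', γ', h1, h2⟩, hsT'⟩ := exists_lt_of_lt_csSup ⟨b, hbA⟩ hs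
      exact ⟨T', γ', fun _ => ⟨hsT', hbT', h1, h2⟩⟩
    · exact ⟨0, γ, fun h => absurd h hs⟩
  choose τ Γ hΓ using hex
  -- The diagonal `r ↦ Γ r r` is the union of the chosen lifts: `τ r > r`, so `Γ r` is a lift at
  -- `r`.
  have hagree : ∀ s < T, EqOn (fun r => Γ r r) (Γ s) (Ioo a (τ s) ∩ Iio T) := by
    rintro s hs r ⟨hr, hrT⟩
    obtain ⟨h1, h2, h3, h4⟩ := hΓ s hs
    obtain ⟨h1', h2', h3', h4'⟩ := hΓ r hrT
    refine IsLineLift.eqOn hf.isLocallyInjective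
      (h3'.mono (Ioo_subset_Ioo_right (min_le_right (τ s) (τ r))))
      (h3.mono (Ioo_subset_Ioo_right (min_le_left (τ s) (τ r))))
      (c := c) ⟨hac, lt_min (by linarith) (by linarith)⟩ (h4'.trans h4.symm)
      ⟨hr.1, lt_min hr.2 h1'⟩
  have hmax : IsLineLift f p v (fun r => Γ r r) (Ioo a T) := by
    refine ⟨fun s hs => ContMDiffAt.contMDiffWithinAt ?_, fun s hs => ?_⟩
    · obtain ⟨h1, h2, h3, h4⟩ := hΓ s hs.2
      refine (h3.contMDiffOn.contMDiffAt
        (isOpen_Ioo.mem_nhds ⟨hs.1, h1⟩)).congr_of_eventuallyEq ?_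
      filter_upwards [isOpen_Ioo.mem_nhds (⟨hs.1, h1⟩ : s ∈ Ioo a (τ s)), Iio_mem_nhds hs.2]
        with r hr hrT using hagree s hs.2 ⟨hr, hrT⟩
    · obtain ⟨h1, h2, h3, h4⟩ := hΓ s hs.2
      exact h3.apply_eq s ⟨hs.1, h1⟩
  obtain ⟨u, -, hu, huT⟩ := exists_seq_strictMono_tendsto' (show a < T by linarith)
  obtain ⟨y, hy⟩ := hcomplete (fun n => Γ (u n) (u n)) (by
    intro ε hε
    obtain ⟨η, hη, hηε⟩ := ENNReal.lt_iff_exists_nnreal_btwn.1 hε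
    obtain ⟨N, hN⟩ := Metric.cauchySeq_iff.1 huT.cauchySeq η (by exact_mod_cast hη)
    refine ⟨N, fun m hm n hn => ?_⟩
    refine (hmax.intrinsicEDist_le_abs hv ordConnected_Ioo (hu m) (hu n)).trans_lt
      (lt_of_le_of_lt ?_ hηε)
    rw [ENNReal.ofReal_le_iff_le_toReal ENNReal.coe_ne_top, ENNReal.coe_toReal]
    exact (hN n hn m hm).le)
  obtain ⟨T', hT', s, hs, γ', hγ', heq⟩ := hf.exists_extension_of_tendsto hv hmax
    (show c < T by linarith) hu huT hy
  have hT'A : T' ∈ A := by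
    refine ⟨by linarith, γ', hγ', ?_⟩
    rw [heq hs]
    exact (hΓ c (by linarith)).2.2.2
  exact absurd (le_csSup hA hT'A) (not_le.2 hT')

/-- Lifts are extended to the right only; points at or before `a` are reached by reversing the
parameter and replacing `v` by `-v`. -/
theorem IsMinimalImmersion.line_mem_range [T2Space S] (hf : IsMinimalImmersion f)
    (hcomplete : IsCompleteSurface f) {p v : Space} (hv : ‖v‖ = 1) {γ : ℝ → S} {a b : ℝ}
    (hab : a < b) (hγ : IsLineLift f p v γ (Ioo a b)) (t : ℝ) : p + t • v ∈ range f := by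
  rcases lt_or_ge a t with h | h
  · obtain ⟨T, hT, γ', hγ'⟩ := hf.exists_isLineLift_Ioo hcomplete hv hab hγ t
    exact ⟨γ' t, hγ'.apply_eq t ⟨h, hT⟩⟩
  · have hneg : IsLineLift f p (-v) (fun s => γ (-s)) (Ioo (-b) (-a)) :=
      hγ.comp_neg.mono fun s hs => ⟨by linarith [hs.2], by linarith [hs.1]⟩
    obtain ⟨T, hT, γ', hγ'⟩ := hf.exists_isLineLift_Ioo hcomplete (by rwa [norm_neg])
      (neg_lt_neg hab) hneg (-t)
    refine ⟨γ' (-t), ?_⟩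
    rw [hγ'.apply_eq (-t) ⟨by linarith, hT⟩]
    simp

end Lifts

theorem propositionP {S : Type*} [TopologicalSpace S] [T2Space S] [SecondCountableTopology S]
    [ChartedSpace Plane S] [IsManifold (𝓡 2) 2 S] (f : S → Space)
    (hmin : IsMinimalImmersion f) (hcomplete : IsCompleteSurface f)
    (p q : Space) (hpq : p ≠ q) (hseg : segment ℝ p q ⊆ range f) :
    (line[ℝ, p, q] : Set Space) ⊆ range f := by
  have hne : ‖q - p‖ ≠ 0 := norm_ne_zero_iff.2 (sub_ne_zero.2 hpq.symm)
  have hpos : 0 < ‖q - p‖ := norm_pos_iff.2 (sub_ne_zero.2 hpq.symm)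
  set v : Space := ‖q - p‖⁻¹ • (q - p) with hvdef
  have hv : ‖v‖ = 1 := by
    rw [hvdef, norm_smul, norm_inv, norm_norm, inv_mul_cancel₀ hne]
  obtain ⟨a, b, γ, hab, hγ⟩ := hmin.exists_isLineLift (p := p) (v := v) hpos (by
    intro t ht
    apply hseg
    rw [segment_eq_image']
    refine ⟨t / ‖q - p‖, ⟨div_nonneg ht.1 hpos.le, (div_le_one hpos).2 ht.2⟩, ?_⟩
    simp only [hvdef, smul_smul, div_eq_mul_inv])
  rintro x hx
  obtain ⟨r, rfl⟩ := mem_affineSpan_pair_iff_exists_lineMap_eq.1 hx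
  -- The point `p + r (q - p)` has arc length parameter `r * ‖q - p‖`, as `v` is the unit direction.
  have h := hmin.line_mem_range hcomplete hv hab hγ (r * ‖q - p‖)
  rw [hvdef, smul_smul, mul_assoc, mul_inv_cancel₀ hne, mul_one] at h
  rw [AffineMap.lineMap_apply]
  simpa [add_comm] using h
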